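/- Let $\alpha \approx 0.78265213$ be the second largest real root of $$54675a^4-2442195a^3+2182800a^2-115424a-96429 .$$ Put $\gamma_k=(k+1)/k$ for odd $k$ and $\gamma_k=1$ for even $k$. For $\beta\in\mathbb R$ say that a sequence $\{a_k\}_{k\ge1}$ of nonnegative real numbers is $\beta$-admissible if $$a_{2j-1}\ge \frac{2j}{2j-1}\,a_{2j}\quad (j\ge 1),\qquad a_2\ge \frac{3\beta}{4}\,a_3,\qquad a_{2j}\ge \frac{2j+1}{2j+2}\,a_{2j+1}\quad (j\ge 2).$$ (i) If $\{a_k\}$ is $\alpha$-admissible, then $\sum_{k=1}^n a_k\sin(kx)\ge 0$ for all $x\in[0,\pi]$ and all $n\ge1$. (ii) Write $\{a_k\}\succeq\{b_k\}$ if $a_k=0$ implies $b_k=0$ and, over the indices $k$ with $a_k\ne 0$, the quotients $b_k/a_k$ are nonnegative and nonincreasing. The sequence $\{2\alpha,\alpha,\gamma_3,\gamma_4,\gamma_5,\dots\}$ is maximal among the $\alpha$-admissible sequences: it is $\alpha$-admissible, and $\{2\alpha,\alpha,\gamma_3,\gamma_4,\dots\}\succeq\{a_k\}$ for every $\alpha$-admissible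 $\{a_k\}$. (iii) The value $\alpha$ is best possible: for every $\beta<\alpha$ the fifth partial sum $$2\beta\sin x+\beta\sin 2x+\gamma_3\sin 3x+\gamma_4\sin 4x+\gamma_5\sin 5x$$ takes a negative value somewhere in $[0,\pi]$, while for $0<\beta<\alpha$ the sequence $\{2\beta,\beta,\gamma_3,\gamma_4,\dots\}$ is $\beta$-admissible. -/

import Mathlib

/-- The quartic polynomial `54675 a⁴ - 2442195 a³ + 2182800 a² - 115424 a - 96429`. -/
def quartic (a : ℝ) : ℝ :=
  54675 * a ^ 4 - 2442195 * a ^ 3 + 2182800 * a ^ 2 - 115424 * a - 96429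

/-- The real roots of the quartic that are not its largest real root. -/
def nonLargestRoots : Set ℝ :=
  {x | quartic x = 0 ∧ ∃ y, quartic y = 0 ∧ x < y}

/-- The second largest real root of the quartic. That this supremum is attained
(so that it really is the second largest root) is part of the theorem. -/
noncomputable def alpha : ℝ := sSup nonLargestRoots

/-- The `n`-th partial sum of `∑ a_k sin (k x)`. Sequences are indexed by `k ≥ 1`;
the value `a 0` is never used. -/
noncomputable def sinePartialSum (a : ℕ → ℝ) (n : ℕ) (x : ℝ) : ℝ :=
  ∑ k ∈ Finset.Icc 1 n, a k * Real.sin (k * x)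

/-- The `n`-th partial sum of `∑ a_k sin (k x)` is nonnegative on `[0, π]`. -/
def IsNN (a : ℕ → ℝ) (n : ℕ) : Prop :=
  ∀ x ∈ Set.Icc (0 : ℝ) Real.pi, 0 ≤ sinePartialSum a n x

/-- `∑ a_k sin (k x)` is a P-sum on `[0, π]`: all its partial sums are nonnegative there. -/
def IsPSum (a : ℕ → ℝ) : Prop :=
  ∀ n : ℕ, IsNN a n

/-- The coefficient conditions with parameter `β` in the place of `α`, for a sequence
of nonnegative numbers. -/
structure Admissible (β : ℝ) (a : ℕ → ℝ) : Prop where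
  nonneg : ∀ k : ℕ, 1 ≤ k → 0 ≤ a k
  vietoris : ∀ j : ℕ, 1 ≤ j → a (2 * j - 1) ≥ (2 * j : ℝ) / (2 * j - 1) * a (2 * j)
  two_three : a 2 ≥ 3 * β / 4 * a 3
  even_odd : ∀ j : ℕ, 2 ≤ j → a (2 * j) ≥ (2 * j + 1 : ℝ) / (2 * j + 2) * a (2 * j + 1)

/-- `γ_k = (k + 1) / k` for odd `k` and `γ_k = 1` for even `k`. -/
noncomputable def gammaSeq (k : ℕ) : ℝ :=
  if Odd k then ((k : ℝ) + 1) / k else 1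

/-- The sequence `2β, β, γ₃, γ₄, γ₅, …`. -/
noncomputable def phiOne (β : ℝ) (k : ℕ) : ℝ :=
  if k = 1 then 2 * β else if k = 2 then β else gammaSeq k

/-- The comparison order `{a_k} ⪰ {b_k}`: `b` vanishes wherever `a` does and, over the indices
with `a_k ≠ 0`, the quotients `b_k / a_k` are nonincreasing and nonnegative. -/
structure Dominates (a b : ℕ → ℝ) : Prop where
  zero : ∀ k : ℕ, 1 ≤ k → a k = 0 → b k = 0
  anti : ∀ i k : ℕ, 1 ≤ i → i ≤ k → a i ≠ 0 → a k ≠ 0 → b k / a k ≤ b i / a i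
  nonneg : ∀ k : ℕ, 1 ≤ k → a k ≠ 0 → 0 ≤ b k / a k

/-!
A sequence dominated by `p` inherits nonnegative sine sums from `p` by Abel summation, and the
admissibility conditions say that the quotients `a k / phiOne β k` are nonnegative and decrease. So
everything reduces to the sine sums of `phiOne α`. These are increasing in the parameter, and
already the value `0.7826 < α` makes all of them nonnegative except the fifth: the sum of `phiOne β`
is a conjugate Dirichlet kernel plus a partial sum of the square wave minus an explicit term, which
gives uniform bounds for `15 ≤ n`, and each smaller `n` leaves one polynomial in `cos x` to check on
`[-1, 1]`.

The fifth sum, divided by `sin x`, is `2 β (1 + z) + q z` with `z = cos x`. Hence the best parameter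
is the maximum of `-q z / (2 (1 + z))`; at that value of `β` the polynomial has a double root, and
eliminating the root yields the quartic.
-/

open Real

/-! ### Certified nonnegativity of rational polynomials -/

/-- Polynomials with rational coefficients as coefficient lists, constant term first. In contrast
to `Polynomial ℚ`, they can be evaluated by the kernel. -/
abbrev CoeffList := List ℚ

namespace CoeffList

/-- The value of a polynomial at a point of a division ring, by Horner's scheme. -/
def eval {K : Type*} [DivisionRing K] : CoeffList → K → K
  | [], _ => 0
  | a :: p, x => a + x * eval p x

/-- The sum of two polynomials. -/
def add : CoeffList → CoeffList → CoeffList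
  | [], q => q
  | p, [] => p
  | a :: p, b :: q => (a + b) :: add p q

/-- The product of a polynomial with a constant. -/
def smul (c : ℚ) (p : CoeffList) : CoeffList := p.map (c * ·)

/-- The polynomial `c + (u + v X) p`, the elementary step of `comp`. -/
def addMulLinear (u v : ℚ) : ℚ → CoeffList → CoeffList
  | c, [] => [c]
  | c, a :: p => (c + u * a) :: addMulLinear u v (v * a) p

/-- The composition of a polynomial with the affine map `u + v X`. -/
def comp (u v : ℚ) : CoeffList → CoeffList
  | [] => []
  | a :: p => addMulLinear u v a (comp u v p)

/-- The lower bound for a polynomial on `[0, 1]` that interval arithmetic extracts from Horner's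
scheme. -/
def lowerBound : CoeffList → ℚ
  | [] => 0
  | a :: p => a + min 0 (lowerBound p)

/-- A test for the nonnegativity of `p` on the segment from `u` to `u + v`: the segment is bisected
at most `d` times until `lowerBound` is nonnegative on every piece. -/
def nonnegOn (p : CoeffList) : ℕ → ℚ → ℚ → Bool
  | 0, u, v => decide (0 ≤ lowerBound (comp u v p))
  | d + 1, u, v => decide (0 ≤ lowerBound (comp u v p)) ||
      (nonnegOn p d u (v / 2) && nonnegOn p d (u + v / 2) (v / 2))

section Eval

variable {K : Type*} [Field K] [CharZero K]

lemma eval_add (p q : CoeffList) (x : K) : eval (add p q) x = eval p x + eval q x := by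
  fun_induction add p q with
  | case1 => simp [eval]
  | case2 => simp [eval]
  | case3 a p b q ih => simp only [eval, ih]; push_cast; ring

lemma eval_smul (c : ℚ) (p : CoeffList) (x : K) : eval (smul c p) x = c * eval p x := by
  induction p with
  | nil => simp [smul, eval]
  | cons a p ih =>
    simp only [smul, List.map_cons, eval] at ih ⊢
    rw [ih]
    push_cast
    ring

lemma eval_addMulLinear (u v c : ℚ) (p : CoeffList) (x : K) :
    eval (addMulLinear u v c p) x = c + (u + v * x) * eval p x := by
  induction p generalizing c with
  | nil => simp [addMulLinear, eval]
  | cons a p ih => simp only [addMulLinear, eval, ih]; push_cast; ring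

lemma eval_comp (u v : ℚ) (p : CoeffList) (x : K) : eval (comp u v p) x = eval p (u + v * x) := by
  induction p with
  | nil => rfl
  | cons a p ih => rw [comp, eval_addMulLinear, ih, eval]

end Eval

section Order

variable {K : Type*} [Field K] [LinearOrder K] [IsStrictOrderedRing K]

lemma lowerBound_le_eval (p : CoeffList) {x : K} (h0 : 0 ≤ x) (h1 : x ≤ 1) :
    (lowerBound p : K) ≤ eval p x := by
  induction p with
  | nil => simp [lowerBound, eval]
  | cons a p ih =>
    simp only [lowerBound, eval]
    push_cast
    gcongr
    rcases le_total 0 (eval p x) with h | h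
    · exact (min_le_left _ _).trans (mul_nonneg h0 h)
    · calc min 0 (lowerBound p : K) ≤ eval p x := (min_le_right _ _).trans ih
        _ ≤ x * eval p x := le_mul_of_le_one_left h h1

lemma eval_nonneg_of_nonnegOn {p : CoeffList} {d : ℕ} {u v : ℚ} (h : nonnegOn p d u v) {t : K}
    (h0 : 0 ≤ t) (h1 : t ≤ 1) : 0 ≤ eval p (u + v * t) := by
  have of_lowerBound {u v : ℚ} (h : 0 ≤ lowerBound (comp u v p)) {t : K} (h0 : 0 ≤ t)
      (h1 : t ≤ 1) : 0 ≤ eval p (u + v * t) :=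
    calc (0 : K) ≤ lowerBound (comp u v p) := by exact_mod_cast h
      _ ≤ eval (comp u v p) t := lowerBound_le_eval _ h0 h1
      _ = eval p (u + v * t) := eval_comp u v p t
  induction d generalizing u v t with
  | zero => exact of_lowerBound (by simpa [nonnegOn] using h) h0 h1
  | succ d ih =>
    simp only [nonnegOn, Bool.or_eq_true, Bool.and_eq_true, decide_eq_true_eq] at h
    rcases h with h | ⟨hl, hr⟩
    · exact of_lowerBound h h0 h1
    · rcases le_total t (1 / 2) with ht | ht
      · convert ih hl (t := 2 * t) (by linarith) (by linarith) using 2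
        push_cast
        ring
      · convert ih hr (t := 2 * t - 1) (by linarith) (by linarith) using 2
        push_cast
        ring

end Order

/-- The Chebyshev polynomials of the second kind, by their recurrence. -/
def chebyshevU : ℕ → CoeffList
  | 0 => [1]
  | 1 => [0, 2]
  | n + 2 => add (0 :: smul 2 (chebyshevU (n + 1))) (smul (-1) (chebyshevU n))

/-- The polynomial `∑_{k = 1}^n a k * U_{k - 1}`, which at `cos x` takes the value
`∑_{k = 1}^n a k * sin (k x) / sin x`. -/
def chebyshevSum (a : ℕ → ℚ) : ℕ → CoeffList
  | 0 => []
  | n + 1 => add (chebyshevSum a n) (smul (a (n + 1)) (chebyshevU n))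

lemma eval_chebyshevU (n : ℕ) (x : ℝ) :
    eval (chebyshevU n) x = (Polynomial.Chebyshev.U ℝ n).eval x := by
  fun_induction chebyshevU n with
  | case1 => simp [eval]
  | case2 => simp [eval, mul_comm]
  | case3 n ih₁ ih₀ =>
    push_cast at ih₁ ⊢
    rw [eval_add, eval, eval_smul, eval_smul, ih₁, ih₀,
      show (n : ℤ) + 1 + 1 = n + 2 by ring, Polynomial.Chebyshev.U_add_two]
    simp only [Rat.cast_zero, Rat.cast_neg, Rat.cast_one, Rat.cast_ofNat, zero_add, neg_mul,
      one_mul, Polynomial.eval_sub, Polynomial.eval_mul, Polynomial.eval_ofNat, Polynomial.eval_X]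
    ring

end CoeffList

/-! ### Sine sums -/

lemma sinePartialSum_succ (a : ℕ → ℝ) (n : ℕ) (x : ℝ) :
    sinePartialSum a (n + 1) x = sinePartialSum a n x + a (n + 1) * sin ((n + 1 : ℕ) * x) :=
  Finset.sum_Icc_succ_top (by omega) _

lemma sinePartialSum_eq_sin_mul_eval (a : ℕ → ℚ) (n : ℕ) (x : ℝ) :
    sinePartialSum (fun k ↦ a k) n x =
      sin x * CoeffList.eval (CoeffList.chebyshevSum a n) (cos x) := by
  induction n with
  | zero => simp [sinePartialSum, CoeffList.chebyshevSum, CoeffList.eval]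
  | succ n ih =>
    have hU := Polynomial.Chebyshev.U_real_cos x n
    rw [sinePartialSum_succ, ih, CoeffList.chebyshevSum, CoeffList.eval_add, CoeffList.eval_smul,
      CoeffList.eval_chebyshevU]
    push_cast at hU ⊢
    rw [← hU]
    ring

lemma isNN_of_nonnegOn {a : ℕ → ℚ} {n d : ℕ}
    (h : CoeffList.nonnegOn (CoeffList.chebyshevSum a n) d (-1) 2) : IsNN (fun k ↦ a k) n := by
  intro x hx
  have hcos : cos x = (-1 : ℚ) + (2 : ℚ) * ((1 + cos x) / 2) := by push_cast; ring
  rw [sinePartialSum_eq_sin_mul_eval, hcos]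
  exact mul_nonneg (sin_nonneg_of_nonneg_of_le_pi hx.1 hx.2) <|
    CoeffList.eval_nonneg_of_nonnegOn h (by linarith [neg_one_le_cos x])
      (by linarith [cos_le_one x])

lemma sinePartialSum_nonneg_of_mul_le_pi {a : ℕ → ℝ} (ha : ∀ k, 1 ≤ k → 0 ≤ a k) {n : ℕ} {x : ℝ}
    (h0 : 0 ≤ x) (h1 : n * x ≤ π) : 0 ≤ sinePartialSum a n x := by
  refine Finset.sum_nonneg fun k hk ↦ ?_
  obtain ⟨hk1, hkn⟩ := Finset.mem_Icc.1 hk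
  have hkx : k * x ≤ π := (mul_le_mul_of_nonneg_right (by exact_mod_cast hkn) h0).trans h1
  exact mul_nonneg (ha k hk1) (sin_nonneg_of_nonneg_of_le_pi (by positivity) hkx)

lemma mul_sin_le_sin_mul {t θ : ℝ} (ht0 : 0 ≤ t) (ht1 : t ≤ 1) (h0 : 0 ≤ θ) (h1 : θ ≤ π) :
    t * sin θ ≤ sin (t * θ) := by
  have := strictConcaveOn_sin_Icc.concaveOn.2 (⟨h0, h1⟩ : θ ∈ Set.Icc 0 π)
    (⟨le_rfl, pi_pos.le⟩ : (0 : ℝ) ∈ Set.Icc 0 π) ht0 (sub_nonneg.2 ht1) (by ring)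
  simpa using this

lemma nat_mul_sin_succ_mul_le {k : ℕ} {y : ℝ} (h0 : 0 ≤ y) (h1 : (k + 1) * y ≤ π) :
    k * sin ((k + 1) * y) ≤ (k + 1) * sin (k * y) := by
  have hk : (0 : ℝ) < k + 1 := by positivity
  have h := mul_sin_le_sin_mul (t := k / (k + 1)) (by positivity)
    ((div_le_one hk).2 (by linarith)) (by positivity) h1
  have hky : k / (k + 1) * ((k + 1) * y) = k * y := by field_simp
  rwa [hky, div_mul_eq_mul_div, div_le_iff₀' hk] at h

lemma sinePartialSum_two_mul_pi_sub_nonneg {a : ℕ → ℝ} (ha : ∀ k, 1 ≤ k → 0 ≤ a k)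
    (hpair : ∀ j : ℕ, (2 * j + 2) * a (2 * j + 2) ≤ (2 * j + 1) * a (2 * j + 1)) {j : ℕ} {y : ℝ}
    (h0 : 0 ≤ y) (h1 : 2 * j * y ≤ π) : 0 ≤ sinePartialSum a (2 * j) (π - y) := by
  induction j with
  | zero => simp [sinePartialSum]
  | succ j ih =>
    push_cast at h1
    have hstep : (2 * j + 1) * sin ((2 * j + 2) * y) ≤ (2 * j + 2) * sin ((2 * j + 1) * y) := by
      have := nat_mul_sin_succ_mul_le (k := 2 * j + 1) h0 (by push_cast; linarith)
      push_cast at this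
      simpa only [add_assoc, one_add_one_eq_two] using this
    have hsin : 0 ≤ sin ((2 * j + 1) * y) :=
      sin_nonneg_of_nonneg_of_le_pi (by positivity) (by linarith)
    have hodd : sin ((2 * j + 1 : ℕ) * (π - y)) = sin ((2 * j + 1) * y) := by
      rw [mul_sub, sin_nat_mul_pi_sub, Odd.neg_one_pow ⟨j, rfl⟩]
      push_cast
      ring
    have heven : sin ((2 * j + 1 + 1 : ℕ) * (π - y)) = -sin ((2 * j + 2) * y) := by
      rw [mul_sub, sin_nat_mul_pi_sub, Even.neg_one_pow ⟨j + 1, by ring⟩]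
      push_cast
      ring_nf
    rw [show 2 * (j + 1) = 2 * j + 1 + 1 by ring, sinePartialSum_succ, sinePartialSum_succ, hodd,
      heven, add_assoc]
    refine add_nonneg (ih (by linarith)) ?_
    have h : (0 : ℝ) ≤ (2 * j + 1) *
        (a (2 * j + 1) * sin ((2 * j + 1) * y) + a (2 * j + 1 + 1) * -sin ((2 * j + 2) * y)) := by
      linarith [mul_le_mul_of_nonneg_right (hpair j) hsin,
        mul_le_mul_of_nonneg_left hstep (ha (2 * j + 2) (by omega))]
    exact nonneg_of_mul_nonneg_right h (by positivity)

lemma sinePartialSum_pi_sub_nonneg {a : ℕ → ℝ} (ha : ∀ k, 1 ≤ k → 0 ≤ a k)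
    (hpair : ∀ j : ℕ, (2 * j + 2) * a (2 * j + 2) ≤ (2 * j + 1) * a (2 * j + 1)) {n : ℕ} {y : ℝ}
    (h0 : 0 ≤ y) (h1 : n * y ≤ π) : 0 ≤ sinePartialSum a n (π - y) := by
  rcases Nat.even_or_odd' n with ⟨j, rfl | rfl⟩
  · exact sinePartialSum_two_mul_pi_sub_nonneg ha hpair h0 (by push_cast at h1; exact h1)
  · have hsin : 0 ≤ sin ((2 * j + 1 : ℕ) * (π - y)) := by
      rw [mul_sub, sin_nat_mul_pi_sub, Odd.neg_one_pow ⟨j, rfl⟩]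
      simpa using sin_nonneg_of_nonneg_of_le_pi (by positivity) h1
    rw [sinePartialSum_succ]
    push_cast at h1
    exact add_nonneg (sinePartialSum_two_mul_pi_sub_nonneg ha hpair h0 (by linarith))
      (mul_nonneg (ha _ (by omega)) hsin)

lemma two_mul_sin_half_mul_sinePartialSum_one (n : ℕ) (x : ℝ) :
    2 * sin (x / 2) * sinePartialSum (fun _ ↦ 1) n x = cos (x / 2) - cos ((n + 1 / 2) * x) := by
  induction n with
  | zero => simp [sinePartialSum, div_eq_inv_mul]
  | succ n ih =>
    rw [sinePartialSum_succ, mul_add, ih, one_mul, two_mul_sin_mul_sin, ← cos_neg (x / 2 - _)]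
    push_cast
    ring_nf

/-! ### The square wave -/

/-- The partial sum with `m` terms of the Fourier series of the square wave of height `π / 4`. -/
noncomputable def squareWaveSum (m : ℕ) (x : ℝ) : ℝ :=
  ∑ j ∈ Finset.range m, sin ((2 * j + 1) * x) / (2 * j + 1)

lemma two_mul_sin_mul_sum_cos (m : ℕ) (x : ℝ) :
    2 * sin x * ∑ j ∈ Finset.range m, cos ((2 * j + 1) * x) = sin (2 * m * x) := by
  calc
    _ = 2 * (sin (2 * x / 2) * ∑ j ∈ Finset.range m, cos (2 * x * j + x)) := by
      rw [mul_div_cancel_left₀ x two_ne_zero, mul_assoc]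
      congr! 4
      ring
    _ = 2 * sin (m * x) * cos (m * x) := by
      rw [sin_mul_sum_cos]
      ring_nf
    _ = sin (2 * m * x) := by rw [← sin_two_mul, mul_assoc]

lemma hasDerivAt_squareWaveSum (m : ℕ) (x : ℝ) :
    HasDerivAt (squareWaveSum m) (∑ j ∈ Finset.range m, cos ((2 * j + 1) * x)) x := by
  refine HasDerivAt.fun_sum fun j _ ↦ ?_
  have hj : 2 * (j : ℝ) + 1 ≠ 0 := by positivity
  have h := (((hasDerivAt_id x).const_mul (2 * (j : ℝ) + 1)).sin).div_const (2 * (j : ℝ) + 1)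
  simpa [hj] using h

lemma squareWaveSum_pi_sub (m : ℕ) (x : ℝ) : squareWaveSum m (π - x) = squareWaveSum m x := by
  refine Finset.sum_congr rfl fun j _ ↦ ?_
  congr 1
  calc sin ((2 * j + 1) * (π - x)) = sin ((2 * j + 1 : ℕ) * π - (2 * j + 1) * x) := by
        push_cast
        ring_nf
    _ = sin ((2 * j + 1) * x) := by
        rw [sin_nat_mul_pi_sub, Odd.neg_one_pow ⟨j, rfl⟩]
        ring

lemma squareWaveSum_pi_div_two (m : ℕ) :
    squareWaveSum m (π / 2) = ∑ j ∈ Finset.range m, (-1 : ℝ) ^ j / (2 * j + 1) := by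
  refine Finset.sum_congr rfl fun j _ ↦ ?_
  congr 1
  calc sin ((2 * j + 1) * (π / 2)) = sin (π / 2 + j * π) := by ring_nf
    _ = (-1) ^ j := by rw [sin_add_nat_mul_pi, sin_pi_div_two, mul_one]

lemma pi_div_four_le_sum_range_odd (k : ℕ) :
    π / 4 ≤ ∑ j ∈ Finset.range (2 * k + 1), (-1 : ℝ) ^ j / (2 * j + 1) := by
  have hanti : Antitone fun j : ℕ ↦ (2 * (j : ℝ) + 1)⁻¹ := fun i j hij ↦ by
    dsimp only
    gcongr
  exact hanti.tendsto_le_alternating_series tendsto_sum_pi_div_four k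

lemma pi_div_four_le_sum_range_add {m : ℕ} (hm : 1 ≤ m) :
    π / 4 ≤ ∑ j ∈ Finset.range m, (-1 : ℝ) ^ j / (2 * j + 1) + (1 + (-1) ^ m) / (4 * m) := by
  rcases Nat.even_or_odd' m with ⟨k, rfl | rfl⟩
  · have h := pi_div_four_le_sum_range_odd k
    have hk : (1 : ℝ) ≤ k := by exact_mod_cast (by omega : 1 ≤ k)
    have hterm : (1 : ℝ) / (2 * (2 * k) + 1) ≤ (1 + 1) / (4 * (2 * k)) := by
      rw [div_le_div_iff₀ (by positivity) (by positivity)]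
      linarith
    rw [Finset.sum_range_succ] at h
    rw [Even.neg_one_pow ⟨k, by ring⟩] at h ⊢
    push_cast at h ⊢
    linarith
  · simpa [Odd.neg_one_pow ⟨k, rfl⟩] using pi_div_four_le_sum_range_odd k

lemma hasDerivAt_squareWaveSum_add {m : ℕ} (hm : m ≠ 0) {x : ℝ} (hx : sin x ≠ 0) :
    HasDerivAt (fun t ↦ squareWaveSum m t + (1 + cos (2 * m * t)) / (4 * m * sin t))
      (-((1 + cos (2 * m * x)) * cos x / (4 * m * sin x ^ 2))) x := by
  have hm' : (m : ℝ) ≠ 0 := by exact_mod_cast hm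
  have hnum := ((hasDerivAt_id x).const_mul (2 * (m : ℝ))).cos.const_add 1
  have hden := (hasDerivAt_sin x).const_mul (4 * (m : ℝ))
  refine ((hasDerivAt_squareWaveSum m x).add (hnum.div hden (by positivity))).congr_deriv ?_
  rw [show ∑ j ∈ Finset.range m, cos ((2 * j + 1) * x) = sin (2 * m * x) / (2 * sin x) by
    rw [← two_mul_sin_mul_sum_cos, mul_div_cancel_left₀ _ (by positivity)]]
  simp only [id]
  field_simp
  ring

/- The term added to `squareWaveSum m` makes the derivative nonpositive on `(0, π / 2]`, and at
`π / 2` it is small enough for the error bound of the Leibniz series. -/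
lemma pi_div_four_le_squareWaveSum_add {m : ℕ} (hm : 1 ≤ m) {x : ℝ} (h0 : 0 < x)
    (h1 : x ≤ π / 2) :
    π / 4 ≤ squareWaveSum m x + (1 + cos (2 * m * x)) / (4 * m * sin x) := by
  have hsin : ∀ t ∈ Set.Icc x (π / 2), 0 < sin t := fun t ht ↦
    sin_pos_of_pos_of_lt_pi (h0.trans_le ht.1) (by linarith [ht.2, pi_pos])
  have hderiv := fun t ht ↦ hasDerivAt_squareWaveSum_add (by omega : m ≠ 0) (hsin t ht).ne'
  have hanti := antitoneOn_of_hasDerivWithinAt_nonpos (convex_Icc x (π / 2))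
    (fun t ht ↦ (hderiv t ht).continuousAt.continuousWithinAt)
    (fun t ht ↦ (hderiv t (interior_subset ht)).hasDerivWithinAt) fun t ht ↦ by
      have ht := interior_subset ht
      have hcos : 0 ≤ cos t :=
        cos_nonneg_of_neg_pi_div_two_le_of_le (by linarith [ht.1, pi_pos]) ht.2
      have hnum : 0 ≤ 1 + cos (2 * m * t) := by linarith [neg_one_le_cos (2 * m * t)]
      rw [neg_nonpos]
      positivity
  calc π / 4 ≤ squareWaveSum m (π / 2) + (1 + cos (2 * m * (π / 2))) / (4 * m * sin (π / 2)) := by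
        rw [squareWaveSum_pi_div_two, sin_pi_div_two, mul_one,
          show 2 * (m : ℝ) * (π / 2) = m * π by ring, cos_nat_mul_pi]
        exact pi_div_four_le_sum_range_add hm
    _ ≤ _ := hanti (Set.left_mem_Icc.2 h1) (Set.right_mem_Icc.2 h1) h1

lemma pi_div_four_sub_le_squareWaveSum {m : ℕ} (hm : 1 ≤ m) {x : ℝ} (h0 : 0 < x) (h1 : x < π) :
    π / 4 - 1 / (2 * m * sin x) ≤ squareWaveSum m x := by
  wlog h : x ≤ π / 2 generalizing x
  · have := this (x := π - x) (by linarith) (by linarith) (by linarith)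
    rwa [squareWaveSum_pi_sub, sin_pi_sub] at this
  have hsin : 0 < sin x := sin_pos_of_pos_of_lt_pi h0 h1
  have hle : (1 + cos (2 * m * x)) / (4 * m * sin x) ≤ 1 / (2 * m * sin x) := by
    calc (1 + cos (2 * m * x)) / (4 * m * sin x) ≤ (1 + 1) / (4 * m * sin x) := by
          gcongr
          exact cos_le_one _
      _ = 1 / (2 * m * sin x) := by field_simp; norm_num
  linarith [pi_div_four_le_squareWaveSum_add hm h0 h]

/-! ### The sequences `phiOne β` -/

lemma gammaSeq_two_mul (k : ℕ) : gammaSeq (2 * k) = 1 :=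
  if_neg (by simp)

lemma gammaSeq_two_mul_add_one (k : ℕ) : gammaSeq (2 * k + 1) = 1 + 1 / (2 * k + 1) := by
  rw [gammaSeq, if_pos ⟨k, rfl⟩]
  push_cast
  field_simp

lemma sinePartialSum_gammaSeq (n : ℕ) (x : ℝ) :
    sinePartialSum gammaSeq n x =
      sinePartialSum (fun _ ↦ 1) n x + squareWaveSum ((n + 1) / 2) x := by
  induction n with
  | zero => simp [sinePartialSum, squareWaveSum]
  | succ n ih =>
    rw [sinePartialSum_succ, sinePartialSum_succ, ih]
    rcases Nat.even_or_odd' n with ⟨k, rfl | rfl⟩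
    · rw [gammaSeq_two_mul_add_one, show (2 * k + 1 + 1) / 2 = k + 1 by omega,
        show (2 * k + 1) / 2 = k by omega, squareWaveSum, squareWaveSum, Finset.sum_range_succ]
      push_cast
      ring
    · rw [show 2 * k + 1 + 1 = 2 * (k + 1) by ring, gammaSeq_two_mul,
        show (2 * (k + 1) + 1) / 2 = 2 * (k + 1) / 2 by omega]
      ring

lemma sinePartialSum_phiOne (β : ℝ) {n : ℕ} (hn : 2 ≤ n) (x : ℝ) :
    sinePartialSum (phiOne β) n x =
      sinePartialSum gammaSeq n x - (1 - β) * (2 * sin x * (1 + cos x)) := by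
  induction n, hn using Nat.le_induction with
  | base =>
    simp only [sinePartialSum, Nat.reduceAdd, Nat.one_le_ofNat, Finset.sum_Icc_succ_top,
      Finset.Icc_self, Finset.sum_singleton, phiOne, gammaSeq, ↓reduceIte, OfNat.ofNat_ne_one,
      odd_one, show ¬Odd 2 by decide, Nat.cast_one, Nat.cast_ofNat, div_one, one_mul, sin_two_mul]
    ring
  | succ n hn ih =>
    rw [sinePartialSum_succ, ih, sinePartialSum_succ, phiOne, if_neg (by omega), if_neg (by omega)]
    ring

lemma IsNN.phiOne_mono {β β' : ℝ} (h : β ≤ β') {n : ℕ} (hn : 2 ≤ n) (hβ : IsNN (phiOne β) n) :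
    IsNN (phiOne β') n := by
  intro x hx
  have hsin := sin_nonneg_of_nonneg_of_le_pi hx.1 hx.2
  have hcos : 0 ≤ 1 + cos x := by linarith [neg_one_le_cos x]
  have hdiff : 0 ≤ (β' - β) * (2 * sin x * (1 + cos x)) :=
    mul_nonneg (sub_nonneg.2 h) (by positivity)
  have := hβ x hx
  rw [sinePartialSum_phiOne _ hn] at this ⊢
  linarith

lemma sinePartialSum_phiOne_ge (β : ℝ) {n : ℕ} (hn : 2 ≤ n) {x C : ℝ} (h0 : 0 < x) (h1 : x < π)
    (hC : cos ((n + 1 / 2) * x) ≤ C) :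
    (cos (x / 2) - C) / (2 * sin (x / 2)) + π / 4 - 1 / (n * sin x) -
      (1 - β) * (2 * sin x * (1 + cos x)) ≤ sinePartialSum (phiOne β) n x := by
  have hsin : 0 < sin x := sin_pos_of_pos_of_lt_pi h0 h1
  have hsin₂ : 0 < sin (x / 2) := sin_pos_of_pos_of_lt_pi (by linarith) (by linarith)
  have hone : (cos (x / 2) - C) / (2 * sin (x / 2)) ≤ sinePartialSum (fun _ ↦ 1) n x := by
    rw [div_le_iff₀' (by positivity), two_mul_sin_half_mul_sinePartialSum_one]
    linarith
  have hn' : (n : ℝ) ≤ 2 * ((n + 1) / 2 : ℕ) := by exact_mod_cast (by omega : n ≤ 2 * ((n + 1) / 2))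
  have hle : 1 / (2 * ((n + 1) / 2 : ℕ) * sin x) ≤ 1 / (n * sin x) := by gcongr
  rw [sinePartialSum_phiOne β hn, sinePartialSum_gammaSeq]
  linarith [pi_div_four_sub_le_squareWaveSum (m := (n + 1) / 2) (by omega) h0 h1]

lemma phiOne_nonneg {β : ℝ} (hβ : 0 ≤ β) (k : ℕ) : 0 ≤ phiOne β k := by
  unfold phiOne gammaSeq
  split_ifs <;> positivity

lemma phiOne_two_mul (β : ℝ) {j : ℕ} (hj : 2 ≤ j) : phiOne β (2 * j) = 1 := by
  rw [phiOne, if_neg (by omega), if_neg (by omega), gammaSeq_two_mul]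

lemma phiOne_two_mul_add_one (β : ℝ) {j : ℕ} (hj : 1 ≤ j) :
    phiOne β (2 * j + 1) = (2 * j + 2) / (2 * j + 1) := by
  rw [phiOne, if_neg (by omega), if_neg (by omega), gammaSeq_two_mul_add_one]
  field_simp
  ring

lemma mul_phiOne_even_eq_mul_phiOne_odd (β : ℝ) (j : ℕ) :
    (2 * j + 2) * phiOne β (2 * j + 2) = (2 * j + 1) * phiOne β (2 * j + 1) := by
  rcases Nat.eq_zero_or_pos j with rfl | hj
  · simp [phiOne]
  · rw [show 2 * j + 2 = 2 * (j + 1) by ring, phiOne_two_mul β (by omega),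
      phiOne_two_mul_add_one β hj]
    field_simp

/-! ### Large partial sums -/

lemma mul_le_sin_of_le_quarter {x : ℝ} (h0 : 0 < x) (h1 : x ≤ 1 / 4) : 0.989 * x ≤ sin x := by
  have hsq : x ^ 2 ≤ (1 / 4) ^ 2 := by gcongr
  linarith [sin_gt_sub_cube h0, mul_le_mul_of_nonneg_left hsq h0.le]

lemma one_div_mul_sin_le {c N x : ℝ} (h0 : 0 < x) (h1 : x ≤ 1 / 4) (hN : 0 ≤ N) (hc : 0 < c)
    (h : c ≤ N * x) : 1 / (N * sin x) ≤ 1 / (0.989 * c) := by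
  refine one_div_le_one_div_of_le (by positivity) ?_
  calc 0.989 * c ≤ N * (0.989 * x) := by linarith
    _ ≤ N * sin x := by gcongr; exact mul_le_sin_of_le_quarter h0 h1

lemma sinePartialSum_phiOne_nonneg_of_le_quarter {n : ℕ} (hn : 2 ≤ n) {x : ℝ} (h0 : 0 < x)
    (h1 : x ≤ 1 / 4) (hnx : π ≤ n * x) : 0 ≤ sinePartialSum (phiOne 0.7826) n x := by
  have hpi := pi_gt_d4
  have hsum := sinePartialSum_phiOne_ge 0.7826 hn h0 (by linarith) (cos_le_one _)
  have hwave : 1 / (n * sin x) ≤ 1 / 3 :=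
    (one_div_mul_sin_le h0 h1 n.cast_nonneg pi_pos hnx).trans
      (one_div_le_one_div_of_le (by norm_num) (by linarith))
  have hsq : x ^ 2 ≤ 1 / 4 * x := by nlinarith
  have hdirichlet : -(1 / 20) ≤ (cos (x / 2) - 1) / (2 * sin (x / 2)) := by
    have hsin := mul_le_sin_of_le_quarter (x := x / 2) (by linarith) (by linarith)
    rw [le_div_iff₀ (by linarith)]
    linarith [one_sub_sq_div_two_le_cos (x := x / 2)]
  have hphi : 2 * sin x * (1 + cos x) ≤ 1 := by
    calc 2 * sin x * (1 + cos x) ≤ 2 * (1 / 4) * (1 + 1) := by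
          gcongr
          · linarith [neg_one_le_cos x]
          · exact (sin_lt h0).le.trans h1
          · exact cos_le_one x
      _ = 1 := by norm_num
  linarith

lemma abs_cos_mul_pi_sub (n : ℕ) (y : ℝ) :
    |cos ((n + 1 / 2) * (π - y))| = |sin ((n + 1 / 2) * y - π)| := by
  have harg : ((n : ℝ) + 1 / 2) * (π - y) = π / 2 - (n + 1 / 2) * y + n * π := by ring
  rw [harg, cos_add_nat_mul_pi, abs_mul, abs_neg_one_pow, one_mul, cos_pi_div_two_sub, sin_sub_pi,
    abs_neg]

lemma neg_half_le_dirichlet_pi_sub {y C : ℝ} (h0 : 0 < y) (h1 : y ≤ 1 / 4) (hC : C ≤ 1) :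
    -(C / 2) ≤ (cos ((π - y) / 2) - C) / (2 * sin ((π - y) / 2)) := by
  rw [sub_div π, cos_pi_div_two_sub, sin_pi_div_two_sub]
  have hsin := mul_le_sin_of_le_quarter (x := y / 2) (by linarith) (by linarith)
  have hcos := one_sub_sq_div_two_le_cos (x := y / 2)
  have hsq : y ^ 2 ≤ 1 / 4 * y := by nlinarith
  have hmul : C * (1 - cos (y / 2)) ≤ 1 - cos (y / 2) :=
    mul_le_of_le_one_left (by linarith [cos_le_one (y / 2)]) hC
  rw [le_div_iff₀ (by linarith)]
  linarith

lemma sinePartialSum_phiOne_pi_sub_ge {n : ℕ} (hn : 2 ≤ n) {y c C : ℝ} (h0 : 0 < y)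
    (h1 : y ≤ 1 / 4) (hc : 0 < c) (hcy : c ≤ n * y) (hC1 : C ≤ 1)
    (hC : cos ((n + 1 / 2) * (π - y)) ≤ C) :
    π / 4 - C / 2 - 1 / (0.989 * c) - 0.0035 ≤ sinePartialSum (phiOne 0.7826) n (π - y) := by
  have hpi := pi_gt_d4
  have hsum := sinePartialSum_phiOne_ge 0.7826 hn (by linarith) (by linarith) hC
  have hwave := one_div_mul_sin_le h0 h1 n.cast_nonneg hc hcy
  have hphi : 2 * sin y * (1 + -cos y) ≤ 1 / 64 := by
    have hsq : y ^ 2 ≤ (1 / 4) ^ 2 := by gcongr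
    calc 2 * sin y * (1 + -cos y) ≤ 2 * (1 / 4) * (1 / 32) := by
          gcongr
          · linarith [cos_le_one y]
          · exact (sin_lt h0).le.trans h1
          · linarith [one_sub_sq_div_two_le_cos (x := y)]
      _ = 1 / 64 := by norm_num
  rw [sin_pi_sub, cos_pi_sub] at hsum
  linarith [neg_half_le_dirichlet_pi_sub h0 h1 hC1]

lemma sinePartialSum_phiOne_pi_sub_nonneg {n : ℕ} (hn : 2 ≤ n) {y : ℝ} (h0 : 0 < y)
    (h1 : y ≤ 1 / 4) (hny : π ≤ n * y) : 0 ≤ sinePartialSum (phiOne 0.7826) n (π - y) := by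
  have hpi := pi_gt_d4
  rcases le_total 3.7 (n * y) with hfar | hnear
  · refine le_trans ?_
      (sinePartialSum_phiOne_pi_sub_ge hn h0 h1 (by norm_num) hfar le_rfl (cos_le_one _))
    norm_num
    linarith
  · have hC : cos ((n + 1 / 2) * (π - y)) ≤ 0.7 :=
      calc cos ((n + 1 / 2) * (π - y)) ≤ |sin ((n + 1 / 2) * y - π)| :=
            (le_abs_self _).trans_eq (abs_cos_mul_pi_sub n y)
        _ ≤ |(n + 1 / 2) * y - π| := abs_sin_le_abs
        _ ≤ 0.7 := by rw [abs_le]; constructor <;> linarith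
    refine le_trans ?_
      (sinePartialSum_phiOne_pi_sub_ge hn h0 h1 (by norm_num) (by linarith : 3 ≤ n * y)
        (by norm_num) hC)
    norm_num
    linarith

lemma tan_quarter_mem {x : ℝ} (h0 : 1 / 4 ≤ x) (h1 : x ≤ π - 1 / 4) :
    tan (x / 4) ∈ Set.Icc (1 / 16) (15 / 17) := by
  have hpi := pi_gt_d4
  have hlow : 1 / 16 ≤ tan (x / 4) := by linarith [le_tan (x := x / 4) (by linarith) (by linarith)]
  refine ⟨hlow, ?_⟩
  have hcos : ∀ t ∈ Set.Ioo (-(π / 2)) (π / 2), ∀ k : ℤ, t ≠ (2 * k + 1) * π / 2 := fun t ht ↦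
    cos_ne_zero_iff.1 (cos_pos_of_mem_Ioo ht).ne'
  have hsub := tan_sub' ⟨hcos (π / 4) ⟨by linarith, by linarith⟩,
    hcos (x / 4) ⟨by linarith, by linarith⟩⟩
  have hcompl := le_tan (x := π / 4 - x / 4) (by linarith) (by linarith)
  rw [hsub, tan_pi_div_four, one_mul, le_div_iff₀ (by linarith)] at hcompl
  nlinarith

section TanQuarter

variable {x : ℝ}

lemma cos_half_eq_tan_quarter (h0 : 0 < x) (h1 : x < π) :
    cos (x / 2) = (1 - tan (x / 4) ^ 2) / (1 + tan (x / 4) ^ 2) := by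
  have hcos : 0 < cos (x / 2) := cos_pos_of_mem_Ioo ⟨by linarith, by linarith⟩
  rw [cos_eq_two_mul_tan_half_div_one_sub_tan_half_sq (x / 2) (by linarith),
    show x / 2 / 2 = x / 4 by ring]

lemma sin_half_eq_tan_quarter (x : ℝ) :
    sin (x / 2) = 2 * tan (x / 4) / (1 + tan (x / 4) ^ 2) := by
  rw [sin_eq_two_mul_tan_half_div_one_add_tan_half_sq, show x / 2 / 2 = x / 4 by ring]

lemma sin_eq_tan_quarter (h0 : 0 < x) (h1 : x < π) :
    sin x = 4 * tan (x / 4) * (1 - tan (x / 4) ^ 2) / (1 + tan (x / 4) ^ 2) ^ 2 := by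
  conv_lhs => rw [show x = 2 * (x / 2) by ring]
  rw [sin_two_mul, cos_half_eq_tan_quarter h0 h1, sin_half_eq_tan_quarter]
  field_simp
  ring

lemma one_add_cos_eq_tan_quarter (h0 : 0 < x) (h1 : x < π) :
    1 + cos x = 2 * (1 - tan (x / 4) ^ 2) ^ 2 / (1 + tan (x / 4) ^ 2) ^ 2 := by
  conv_lhs => rw [show x = 2 * (x / 2) by ring]
  rw [cos_two_mul, cos_half_eq_tan_quarter h0 h1]
  field_simp
  ring

end TanQuarter

/-- The numerator of the rational function of `q = tan (x / 4)` that bounds the partial sums from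
below away from `0` and `π`: the multiple of that function by `15000 q (1 - q²) (1 + q²)⁴`. -/
def middlePoly : CoeffList :=
  [-250, 11775, -61176, 35325, 182454, 23550, -333056, -23550, 219954, -35325, -31176, -11775,
    7250]

lemma eval_middlePoly_nonneg {q : ℝ} (hq : q ∈ Set.Icc (1 / 16) (15 / 17)) :
    0 ≤ middlePoly.eval q := by
  have hcert : middlePoly.nonnegOn 6 (1 / 16) (223 / 272) := by decide +kernel
  have hparam : q = (1 / 16 : ℚ) + (223 / 272 : ℚ) * ((q - 1 / 16) / (223 / 272)) := by
    push_cast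
    ring
  rw [hparam]
  exact CoeffList.eval_nonneg_of_nonnegOn hcert (by linarith [hq.1]) (by linarith [hq.2])

lemma sinePartialSum_phiOne_nonneg_of_mem_Icc {n : ℕ} (hn : 15 ≤ n) {x : ℝ} (h0 : 1 / 4 ≤ x)
    (h1 : x ≤ π - 1 / 4) : 0 ≤ sinePartialSum (phiOne 0.7826) n x := by
  have hx0 : 0 < x := by linarith
  have hxpi : x < π := by linarith
  have hsin : 0 < sin x := sin_pos_of_pos_of_lt_pi hx0 hxpi
  have hsum := sinePartialSum_phiOne_ge 0.7826 (by omega : 2 ≤ n) hx0 hxpi (cos_le_one _)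
  have hwave : 1 / (n * sin x) ≤ 1 / (15 * sin x) := by
    have : (15 : ℝ) ≤ n := by exact_mod_cast hn
    gcongr
  have hq := tan_quarter_mem h0 h1
  have hnum := eval_middlePoly_nonneg hq
  rw [sin_eq_tan_quarter hx0 hxpi] at hwave hsum
  rw [one_add_cos_eq_tan_quarter hx0 hxpi, cos_half_eq_tan_quarter hx0 hxpi,
    sin_half_eq_tan_quarter] at hsum
  set q := tan (x / 4)
  have hq0 : 0 < q := by linarith [hq.1]
  have hq1 : 0 < 1 - q ^ 2 := by nlinarith [hq.2]
  have hbound : ((1 - q ^ 2) / (1 + q ^ 2) - 1) / (2 * (2 * q / (1 + q ^ 2))) + 157 / 200 -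
      1 / (15 * (4 * q * (1 - q ^ 2) / (1 + q ^ 2) ^ 2)) -
      (1 - 0.7826) * (2 * (4 * q * (1 - q ^ 2) / (1 + q ^ 2) ^ 2) *
        (2 * (1 - q ^ 2) ^ 2 / (1 + q ^ 2) ^ 2)) =
      middlePoly.eval q / (15000 * (q * (1 - q ^ 2) * (1 + q ^ 2) ^ 4)) := by
    simp only [middlePoly, CoeffList.eval]
    push_cast
    field_simp
    ring
  have : 0 ≤ middlePoly.eval q / (15000 * (q * (1 - q ^ 2) * (1 + q ^ 2) ^ 4)) := by positivity
  linarith [pi_gt_d4]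

lemma isNN_phiOne_of_fifteen_le {n : ℕ} (hn : 15 ≤ n) : IsNN (phiOne 0.7826) n := by
  have hphi : ∀ k, 1 ≤ k → 0 ≤ phiOne 0.7826 k := fun k _ ↦ phiOne_nonneg (by norm_num) k
  have hn0 : (0 : ℝ) < n := by positivity
  rintro x ⟨hx0, hxpi⟩
  rcases le_total (n * x) π with hnx | hnx
  · exact sinePartialSum_nonneg_of_mul_le_pi hphi hx0 hnx
  have hx0' : 0 < x := pos_of_mul_pos_right (pi_pos.trans_le hnx) hn0.le
  rcases le_total x (1 / 4) with hleft | hleft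
  · exact sinePartialSum_phiOne_nonneg_of_le_quarter (by omega) hx0' hleft hnx
  rcases le_total x (π - 1 / 4) with hmid | hright
  · exact sinePartialSum_phiOne_nonneg_of_mem_Icc hn hleft hmid
  obtain ⟨y, rfl⟩ : ∃ y, x = π - y := ⟨π - x, by ring⟩
  rcases le_total (n * y) π with hny | hny
  · exact sinePartialSum_pi_sub_nonneg hphi
      (fun j ↦ (mul_phiOne_even_eq_mul_phiOne_odd _ j).le) (by linarith) hny
  · exact sinePartialSum_phiOne_pi_sub_nonneg (by omega)
      (pos_of_mul_pos_right (pi_pos.trans_le hny) hn0.le) (by linarith) hny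

/-! ### The remaining small partial sums -/

/-- The sequence `phiOne β` for rational `β`, with rational values that the kernel can compute. -/
def phiOneRat (β : ℚ) (k : ℕ) : ℚ :=
  if k = 1 then 2 * β else if k = 2 then β else if Odd k then (k + 1) / k else 1

lemma cast_phiOneRat (β : ℚ) (k : ℕ) : (phiOneRat β k : ℝ) = phiOne β k := by
  unfold phiOneRat phiOne gammaSeq
  split_ifs <;> push_cast <;> rfl

lemma isNN_phiOne_of_lt_fifteen {n : ℕ} (hn : n < 15) (h5 : n ≠ 5) : IsNN (phiOne 0.7826) n := by
  have certificate : ∀ n < 15, n ≠ 5 →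
      CoeffList.nonnegOn (CoeffList.chebyshevSum (phiOneRat 0.7826) n) 8 (-1) 2 = true := by
    decide +kernel
  convert isNN_of_nonnegOn (certificate n hn h5) using 2 with k
  rw [cast_phiOneRat]
  norm_num

/-! ### The fifth partial sum -/

/-- The polynomial `q` with `γ₃ sin 3x + γ₄ sin 4x + γ₅ sin 5x = sin x * q (cos x)`. -/
noncomputable def fifthQuotient (z : ℝ) : ℝ :=
  96 / 5 * z ^ 4 + 8 * z ^ 3 - 136 / 15 * z ^ 2 - 4 * z - 2 / 15

lemma sinePartialSum_phiOne_five (β x : ℝ) :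
    sinePartialSum (phiOne β) 5 x =
      sin x * (2 * β * (1 + cos x) + fifthQuotient (cos x)) := by
  have hzero : sinePartialSum (phiOne 0) 5 x = sin x * fifthQuotient (cos x) := by
    have hcoeff : CoeffList.chebyshevSum (phiOneRat 0) 5 = [-2 / 15, -4, -136 / 15, 8, 96 / 5] := by
      decide +kernel
    have h := sinePartialSum_eq_sin_mul_eval (phiOneRat 0) 5 x
    simp only [cast_phiOneRat, Rat.cast_zero, hcoeff, CoeffList.eval] at h
    rw [h, fifthQuotient]
    push_cast
    ring
  have h0 := sinePartialSum_phiOne 0 (n := 5) (by norm_num) x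
  have hβ := sinePartialSum_phiOne β (n := 5) (by norm_num) x
  linear_combination hβ - h0 + hzero

lemma exists_criticalCos : ∃ c : ℝ, (0.4229548441 < c ∧ c < 0.4229548442) ∧
    432 * c ^ 4 + 696 * c ^ 3 + 112 * c ^ 2 - 136 * c - 29 = 0 := by
  have hcont : ContinuousOn
      (fun c : ℝ ↦ 432 * c ^ 4 + 696 * c ^ 3 + 112 * c ^ 2 - 136 * c - 29)
      (Set.Icc 0.4229548441 0.4229548442) := by fun_prop
  exact intermediate_value_Ioo (by norm_num) hcont
    (show (0 : ℝ) ∈ Set.Ioo _ _ by constructor <;> norm_num)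

/-- The cosine of the point of `(0, π)` where the fifth partial sum for the parameter `α` vanishes.
Its equation is that of the critical points of `fifthQuotient z / (1 + z)`. -/
noncomputable def criticalCos : ℝ := exists_criticalCos.choose

lemma criticalCos_mem_Ioo : criticalCos ∈ Set.Ioo 0.4229548441 0.4229548442 :=
  exists_criticalCos.choose_spec.1

lemma criticalCos_equation :
    432 * criticalCos ^ 4 + 696 * criticalCos ^ 3 + 112 * criticalCos ^ 2
      - 136 * criticalCos - 29 = 0 :=
  exists_criticalCos.choose_spec.2

/-- The parameter `α`, as the value of `-fifthQuotient z / (2 * (1 + z))` at `criticalCos`, reduced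
modulo the equation of `criticalCos`. -/
noncomputable def criticalValue : ℝ :=
  2 + 136 / 15 * criticalCos - 12 * criticalCos ^ 2 - 192 / 5 * criticalCos ^ 3

lemma criticalValue_mem_Ioo : criticalValue ∈ Set.Ioo 0.78265213 0.78265214 := by
  obtain ⟨h0, h1⟩ := criticalCos_mem_Ioo
  have hsq : 0.4229548441 ^ 2 < criticalCos ^ 2 := by gcongr
  have hsq' : criticalCos ^ 2 < 0.4229548442 ^ 2 := by gcongr
  have hcube : 0.4229548441 ^ 3 < criticalCos ^ 3 := by gcongr
  have hcube' : criticalCos ^ 3 < 0.4229548442 ^ 3 := by gcongr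
  unfold criticalValue
  constructor <;> linarith

lemma two_mul_criticalValue_add_fifthQuotient (z : ℝ) :
    2 * criticalValue * (1 + z) + fifthQuotient z = (z - criticalCos) ^ 2 *
      (96 / 5 * (z + (criticalCos + 5 / 24)) ^ 2 +
        (192 / 5 * criticalCos ^ 2 + 8 * criticalCos - 136 / 15 - 5 / 6)) := by
  unfold criticalValue fifthQuotient
  linear_combination (-2 / 15) * criticalCos_equation

lemma isNN_phiOne_criticalValue_five : IsNN (phiOne criticalValue) 5 := by
  intro x hx
  rw [sinePartialSum_phiOne_five, two_mul_criticalValue_add_fifthQuotient]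
  have hrem : 0 ≤ 192 / 5 * criticalCos ^ 2 + 8 * criticalCos - 136 / 15 - 5 / 6 := by
    nlinarith [criticalCos_mem_Ioo.1]
  have hsin := sin_nonneg_of_nonneg_of_le_pi hx.1 hx.2
  positivity

lemma not_isNN_phiOne_five {β : ℝ} (hβ : β < criticalValue) : ¬ IsNN (phiOne β) 5 := by
  obtain ⟨h0, h1⟩ := criticalCos_mem_Ioo
  have hcos : cos (arccos criticalCos) = criticalCos := cos_arccos (by linarith) (by linarith)
  have hsin : 0 < sin (arccos criticalCos) :=
    sin_pos_of_pos_of_lt_pi (arccos_pos.2 (by linarith)) (by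
      rw [← arccos_neg_one]
      exact arccos_lt_arccos le_rfl (by linarith) (by linarith))
  have hvanish := two_mul_criticalValue_add_fifthQuotient criticalCos
  rw [sub_self] at hvanish
  intro hNN
  have hsum := hNN (arccos criticalCos) ⟨arccos_nonneg _, arccos_le_pi _⟩
  rw [sinePartialSum_phiOne_five, hcos] at hsum
  have hneg : 2 * (β - criticalValue) * (1 + criticalCos) < 0 :=
    mul_neg_of_neg_of_pos (by linarith) (by linarith)
  nlinarith [nonneg_of_mul_nonneg_right hsum hsin]

lemma isPSum_phiOne_criticalValue : IsPSum (phiOne criticalValue) := by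
  have hlo : 0.7826 ≤ criticalValue := by linarith [criticalValue_mem_Ioo.1]
  intro n
  rcases lt_or_ge n 2 with h2 | h2
  · intro x hx
    have hn : (n : ℝ) ≤ 1 := by exact_mod_cast Nat.lt_succ_iff.1 h2
    exact sinePartialSum_nonneg_of_mul_le_pi (fun k _ ↦ phiOne_nonneg (by linarith) k) hx.1
      ((mul_le_of_le_one_left hx.1 hn).trans hx.2)
  rcases eq_or_ne n 5 with rfl | h5
  · exact isNN_phiOne_criticalValue_five
  refine IsNN.phiOne_mono hlo h2 ?_
  rcases lt_or_ge n 15 with hn | hn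
  · exact isNN_phiOne_of_lt_fifteen hn h5
  · exact isNN_phiOne_of_fifteen_le hn

/-! ### The quartic -/

lemma quartic_criticalValue : quartic criticalValue = 0 := by
  unfold quartic criticalValue
  set c := criticalCos
  linear_combination (353753 + 63941896 / 15 * c + 25834496 / 5 * c ^ 2 -
    1413956712 / 25 * c ^ 3 - 185330736 / 5 * c ^ 4 + 905278464 / 5 * c ^ 5 -
    247504896 / 25 * c ^ 6 - 2484338688 / 25 * c ^ 7 + 6879707136 / 25 * c ^ 8) *
    criticalCos_equation

/-- An instance of Descartes' rule of signs. -/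
lemma eq_of_mul_cube_eq {a b c d s t : ℝ} (hb : 0 ≤ b) (hc : 0 ≤ c) (hd : 0 < d) (hs : 0 < s)
    (ht : 0 < t) (es : a * s ^ 3 = b * s ^ 2 + c * s + d)
    (et : a * t ^ 3 = b * t ^ 2 + c * t + d) : s = t := by
  by_contra hne
  wlog hst : s < t generalizing s t
  · exact this ht hs et es (Ne.symm hne) (lt_of_le_of_ne (not_lt.1 hst) (Ne.symm hne))
  have hzero : b * (s ^ 2 * t ^ 2) * (t - s) + c * (s * t) * (t ^ 2 - s ^ 2) +
      d * (t ^ 3 - s ^ 3) = 0 := by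
    linear_combination s ^ 3 * et - t ^ 3 * es
  have hsq : 0 < t ^ 2 - s ^ 2 := by rw [sub_pos]; gcongr
  have hcube : 0 < t ^ 3 - s ^ 3 := by rw [sub_pos]; gcongr
  have hpos : 0 < b * (s ^ 2 * t ^ 2) * (t - s) + c * (s * t) * (t ^ 2 - s ^ 2) +
      d * (t ^ 3 - s ^ 3) := by positivity
  exact hpos.ne' hzero

lemma quartic_add (a t : ℝ) :
    quartic (a + t) = quartic a + t * (54675 * t ^ 3 - ((2442195 - 218700 * a) * t ^ 2 +
      (7326585 * a - 2182800 - 328050 * a ^ 2) * t +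
      (7326585 * a ^ 2 + 115424 - 218700 * a ^ 3 - 4365600 * a))) := by
  unfold quartic
  ring

lemma quartic_root_unique_above {a x y : ℝ} (ha : quartic a = 0) (h0 : 3 / 4 < a) (h1 : a < 1)
    (hax : a < x) (hay : a < y) (hx : quartic x = 0) (hy : quartic y = 0) : x = y := by
  have hb : 0 ≤ 2442195 - 218700 * a := by linarith
  have hc : 0 ≤ 7326585 * a - 2182800 - 328050 * a ^ 2 := by nlinarith
  have hd : 0 < 7326585 * a ^ 2 + 115424 - 218700 * a ^ 3 - 4365600 * a := by
    have hfactor : 0 < 7326585 * a - 218700 * a ^ 2 - 4365600 := by nlinarith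
    nlinarith [mul_pos (by linarith : 0 < a) hfactor]
  have cubic {z : ℝ} (haz : a < z) (hz : quartic z = 0) := by
    have h := quartic_add a (z - a)
    rw [add_sub_cancel, hz, ha, zero_add, eq_comm, mul_eq_zero] at h
    exact sub_eq_zero.1 (h.resolve_left (sub_pos.2 haz).ne')
  exact sub_left_injective <|
    eq_of_mul_cube_eq hb hc hd (sub_pos.2 hax) (sub_pos.2 hay) (cubic hax hx) (cubic hay hy)

lemma isGreatest_nonLargestRoots {a : ℝ} (ha : quartic a = 0) (h0 : 3 / 4 < a) (h1 : a < 1) :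
    IsGreatest nonLargestRoots a := by
  have hcont : ContinuousOn quartic (Set.Icc 1 100) := by unfold quartic; fun_prop
  obtain ⟨y, hy, hroot⟩ := intermediate_value_Icc (by norm_num) hcont
    (show (0 : ℝ) ∈ Set.Icc _ _ by unfold quartic; constructor <;> norm_num)
  refine ⟨⟨ha, y, hroot, h1.trans_le hy.1⟩, ?_⟩
  rintro x ⟨hx, z, hz, hxz⟩
  by_contra! hax
  exact hxz.ne (quartic_root_unique_above ha h0 h1 hax (hax.trans hxz) hx hz)

lemma alpha_eq_criticalValue : alpha = criticalValue := by
  obtain ⟨h0, h1⟩ := criticalValue_mem_Ioo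
  exact (isGreatest_nonLargestRoots quartic_criticalValue (by linarith) (by linarith)).csSup_eq

/-! ### Comparison of admissible sequences -/

lemma phiOne_pos {β : ℝ} (hβ : 0 < β) {k : ℕ} (hk : 1 ≤ k) : 0 < phiOne β k := by
  unfold phiOne gammaSeq
  split_ifs <;> positivity

lemma phiOne_vietoris (β : ℝ) {j : ℕ} (hj : 1 ≤ j) :
    phiOne β (2 * j - 1) = (2 * j : ℝ) / (2 * j - 1) * phiOne β (2 * j) := by
  obtain ⟨i, rfl⟩ := Nat.exists_eq_add_of_le' hj
  have hodd : (2 * i + 1 : ℝ) ≠ 0 := by positivity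
  have hratio := mul_phiOne_even_eq_mul_phiOne_odd β i
  rw [show 2 * (i + 1) - 1 = 2 * i + 1 by omega, show 2 * (i + 1) = 2 * i + 2 by ring]
  push_cast
  rw [show (2 * (i + 1) - 1 : ℝ) = 2 * i + 1 by ring, div_mul_eq_mul_div, eq_div_iff hodd]
  linear_combination -hratio

lemma phiOne_two (β : ℝ) : phiOne β 2 = 3 * β / 4 * phiOne β 3 := by
  rw [phiOne_two_mul_add_one β le_rfl, phiOne, if_neg (by norm_num), if_pos rfl]
  push_cast
  ring

lemma phiOne_even_odd (β : ℝ) {j : ℕ} (hj : 2 ≤ j) :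
    phiOne β (2 * j) = (2 * j + 1 : ℝ) / (2 * j + 2) * phiOne β (2 * j + 1) := by
  rw [phiOne_two_mul β hj, phiOne_two_mul_add_one β (by omega)]
  field_simp

lemma admissible_phiOne {β : ℝ} (hβ : 0 ≤ β) : Admissible β (phiOne β) where
  nonneg k _ := phiOne_nonneg hβ k
  vietoris _ hj := (phiOne_vietoris β hj).ge
  two_three := (phiOne_two β).ge
  even_odd _ hj := (phiOne_even_odd β hj).ge

lemma div_le_div_of_eq_mul_of_mul_le {a a' p p' t : ℝ} (ht : 0 < t) (hp' : 0 < p')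
    (hp : p = t * p') (ha : t * a' ≤ a) : a' / p' ≤ a / p :=
  calc a' / p' = t * a' / p := by rw [hp, mul_div_mul_left _ _ ht.ne']
    _ ≤ a / p := by rw [hp]; gcongr

lemma Admissible.div_phiOne_succ_le {β : ℝ} (hβ : 0 < β) {a : ℕ → ℝ} (ha : Admissible β a) {k : ℕ}
    (hk : 1 ≤ k) : a (k + 1) / phiOne β (k + 1) ≤ a k / phiOne β k := by
  have hpos : 0 < phiOne β (k + 1) := phiOne_pos hβ (by omega)
  obtain ⟨j, rfl | rfl⟩ := Nat.even_or_odd' k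
  · rcases eq_or_ne j 1 with rfl | hj
    · exact div_le_div_of_eq_mul_of_mul_le (by positivity) hpos (phiOne_two β) ha.two_three
    · exact div_le_div_of_eq_mul_of_mul_le (by positivity) hpos (phiOne_even_odd β (by omega))
        (ha.even_odd j (by omega))
  · have hratio : (0 : ℝ) < 2 * (j + 1 : ℕ) / (2 * (j + 1 : ℕ) - 1) := by
      refine div_pos (by positivity) ?_
      push_cast
      linarith [(Nat.cast_nonneg j : (0 : ℝ) ≤ j)]
    exact div_le_div_of_eq_mul_of_mul_le hratio hpos (phiOne_vietoris β (by omega : 1 ≤ j + 1))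
      (ha.vietoris (j + 1) (by omega))

lemma Admissible.dominates {β : ℝ} (hβ : 0 < β) {a : ℕ → ℝ} (ha : Admissible β a) :
    Dominates (phiOne β) a where
  zero _ hk h := absurd h (phiOne_pos hβ hk).ne'
  anti i k hi hik _ _ := by
    induction k, hik using Nat.le_induction with
    | base => exact le_rfl
    | succ k hik ih =>
      exact (ha.div_phiOne_succ_le hβ (hi.trans hik)).trans
        (ih (phiOne_pos hβ (hi.trans hik)).ne')
  nonneg k hk _ := div_nonneg (ha.nonneg k hk) (phiOne_pos hβ hk).le

/-- Abel summation, with a free factor `q` so that the induction can pass over the zeros of `p`. -/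
lemma Dominates.mul_sinePartialSum_le {p a : ℕ → ℝ} (h : Dominates p a) {x : ℝ}
    (hp : ∀ n, 0 ≤ sinePartialSum p n x) (n : ℕ) {q : ℝ}
    (hq : ∀ k, 1 ≤ k → k ≤ n → p k ≠ 0 → q ≤ a k / p k) :
    q * sinePartialSum p n x ≤ sinePartialSum a n x := by
  induction n generalizing q with
  | zero => simp [sinePartialSum]
  | succ n ih =>
    rcases eq_or_ne (p (n + 1)) 0 with hzero | hne
    · rw [sinePartialSum_succ, sinePartialSum_succ, hzero, h.zero (n + 1) (by omega) hzero]
      simpa using ih fun k hk hkn ↦ hq k hk (by omega)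
    · set r := a (n + 1) / p (n + 1) with hr
      have ihr : r * sinePartialSum p n x ≤ sinePartialSum a n x :=
        ih fun k hk hkn hpk ↦ h.anti k (n + 1) hk (by omega) hpk hne
      calc q * sinePartialSum p (n + 1) x ≤ r * sinePartialSum p (n + 1) x :=
            mul_le_mul_of_nonneg_right (hq (n + 1) (by omega) le_rfl hne) (hp (n + 1))
        _ = r * sinePartialSum p n x + a (n + 1) * sin ((n + 1 : ℕ) * x) := by
            rw [sinePartialSum_succ, mul_add, ← mul_assoc, hr, div_mul_cancel₀ _ hne]
        _ ≤ sinePartialSum a (n + 1) x := by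
            rw [sinePartialSum_succ]
            gcongr

lemma Dominates.isPSum {p a : ℕ → ℝ} (h : Dominates p a) (hp : IsPSum p) : IsPSum a := by
  intro n x hx
  simpa only [zero_mul] using
    h.mul_sinePartialSum_le (fun m ↦ hp m x hx) n fun k hk _ hpk ↦ h.nonneg k hk hpk

theorem theorem1 :
    -- `α` is the second largest real root of the quartic, with its numerical value
    (IsGreatest nonLargestRoots alpha ∧ 0.78265213 < alpha ∧ alpha < 0.78265214) ∧
    -- sufficiency of the coefficient conditions
    (∀ a : ℕ → ℝ, Admissible alpha a → IsPSum a) ∧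
    -- the sequence `2α, α, γ₃, γ₄, …` is the greatest admissible one
    (Admissible alpha (phiOne alpha) ∧
      ∀ a : ℕ → ℝ, Admissible alpha a → Dominates (phiOne alpha) a) ∧
    -- `α` cannot be replaced by a smaller number
    (∀ β : ℝ, β < alpha →
      (0 < β → Admissible β (phiOne β)) ∧ ¬ IsNN (phiOne β) 5) := by
  obtain ⟨hlo, hhi⟩ := criticalValue_mem_Ioo
  have hpos : 0 < criticalValue := by linarith
  rw [alpha_eq_criticalValue]
  refine ⟨⟨?_, hlo, hhi⟩, ?_, ⟨?_, ?_⟩, ?_⟩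
  · exact isGreatest_nonLargestRoots quartic_criticalValue (by linarith) (by linarith)
  · exact fun a ha ↦ (ha.dominates hpos).isPSum isPSum_phiOne_criticalValue
  · exact admissible_phiOne hpos.le
  · exact fun a ha ↦ ha.dominates hpos
  · exact fun β hβ ↦ ⟨fun hβ0 ↦ admissible_phiOne hβ0.le, not_isNN_phiOne_five hβ⟩
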